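/- Let $\mathbb F$ be a finite field with $|\mathbb F|>2$. Consider the two-user linear wired network $Y_r(n)=h_{r1}(n)X_1(n)+h_{r2}(n)X_2(n)$, $r\in\{1,2\}$, over $\mathbb F$, in which at every channel use $h_{11}(n),h_{22}(n)\neq 0$ and the cross links are in one of four connectivity states: $A$ ($h_{12}\ne0$, $h_{21}=0$), $B$ ($h_{12}=0$, $h_{21}\neq0$), $C$ ($h_{12}\ne0$, $h_{21}\neq0$), $D$ ($h_{12}=h_{21}=0$). The sequence of states is known to all transmitters and receivers, and state $\sigma\in\{A,B,C,D\}$ occupies a limiting fraction $\lambda_\sigma$ of the channel uses. The transmitters know nothing else about the coefficients, so that a code has to be reliable (its error probability, averaged over the messages, has to vanish uniformly) over all coefficient sequences compatible with the states; the receivers know the coefficients. Rates are normalized by $\log_2|\mathbb F|$ bits per channel use. Assume the symmetric case $\lambda_A=\lambda_B$. In the $X$ channel there are four independent messages $W_{rt}$, $r,t\in\{1,2\}$, where $W_{rt}$ is sent by transmitter $t$ to receiver $r$. Its sum capacity (the supremum of the achievable sum rates $R_{11}+R_{12}+R_{21}+R_{22}$) is $$1+\lambda_D+\min(\lambda_A,\lambda_C).$$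 This is also the sum capacity of the interference channel over the same network, in which only the messages $W_{11}$ and $W_{22}$ are present; hence the two extra messages bring no gain. -/

import Mathlib

open Filter Topology

/-- The four connectivity states of the two-user network (all direct links are always present):
`A`: transmitter 2 is heard at receiver 1, transmitter 1 is not heard at receiver 2;
`B`: transmitter 1 is heard at receiver 2, transmitter 2 is not heard at receiver 1;
`C`: both cross links are present; `D`: no cross link is present. -/
inductive ConnState where
  | A | B | C | D
  deriving DecidableEq

/-- `Linked σ r t`: in state `σ` the link from transmitter `t` to receiver `r` is present.
User 1 has index `0` and user 2 has index `1`. -/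
def Linked (σ : ConnState) (r t : Fin 2) : Prop :=
  r = t ∨ (r = 0 ∧ t = 1 ∧ (σ = .A ∨ σ = .C)) ∨ (r = 1 ∧ t = 0 ∧ (σ = .B ∨ σ = .C))

/-- `lam σ` is the fraction of time that the state sequence `s` spends in state `σ`. -/
def HasTimeFractions (s : ℕ → ConnState) (lam : ConnState → ℝ) : Prop :=
  ∀ σ, Tendsto (fun n : ℕ => (((Finset.range n).filter (fun i => s i = σ)).card : ℝ) / n)
    atTop (𝓝 (lam σ))

/-- Channel coefficients over `n` channel uses: `H i r t` is the coefficient from transmitter `t`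
to receiver `r` at channel use `i`. -/
abbrev Coeffs (F : Type*) (n : ℕ) : Type _ := Fin n → Fin 2 → Fin 2 → F

/-- The coefficients are compatible with the topology: nonzero exactly on the links present. -/
def Compatible {F : Type*} [Field F] (s : ℕ → ConnState) {n : ℕ} (H : Coeffs F n) : Prop :=
  ∀ i r t, H i r t ≠ 0 ↔ Linked (s i) r t

/-- A block code of length `n` with one message `W r t` from every transmitter `t` to every
receiver `r`. Transmitter `t` knows only its own messages (and, the code being designed for a
given state sequence, the topology); the receivers know the channel coefficients. -/
structure XCode (F : Type*) (n : ℕ) where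
  /-- number of values of the message from transmitter `t` to receiver `r` -/
  M : Fin 2 → Fin 2 → ℕ
  M_pos : ∀ r t, 0 < M r t
  enc : (t : Fin 2) → ((r : Fin 2) → Fin (M r t)) → Fin n → F
  dec : (r : Fin 2) → Coeffs F n → (Fin n → F) → (t : Fin 2) → Fin (M r t)

namespace XCode

variable {F : Type*} {n : ℕ}

/-- The tuples of all four messages. -/
abbrev Msgs (c : XCode F n) : Type := (r t : Fin 2) → Fin (c.M r t)

/-- The signal observed at receiver `r`. -/
def output [Field F] (c : XCode F n) (H : Coeffs F n) (W : c.Msgs) (r : Fin 2) : Fin n → F :=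
  fun i => ∑ t, H i r t * c.enc t (fun r' => W r' t) i

/-- Probability, for independent uniformly distributed messages and coefficients `H`, that some
receiver does not recover both of its messages. -/
noncomputable def errorProb [Field F] (c : XCode F n) (H : Coeffs F n) : ℝ :=
  (Nat.card {W : c.Msgs // ∃ r, c.dec r H (c.output H W r) ≠ W r} : ℝ) / Nat.card c.Msgs

/-- Rate of the message from `t` to `r`, in units of `log |F|` per channel use. -/
noncomputable def rate (c : XCode F n) (r t : Fin 2) : ℝ :=
  Real.log (c.M r t) / (n * Real.log (Nat.card F))

end XCode

/-- The rates `R r t` are achievable over the state sequence `s` when only the messages `(r, t)`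
with `active r t` are present (an absent message takes a single value). Since nothing but the
topology is known to the transmitters, one code has to be reliable for all coefficients that are
compatible with the topology. -/
def Achievable (F : Type*) [Field F] (s : ℕ → ConnState) (active : Fin 2 → Fin 2 → Prop)
    (R : Fin 2 → Fin 2 → ℝ) : Prop :=
  (∀ r t, 0 ≤ R r t) ∧
  ∀ ε > 0, ∀ᶠ n : ℕ in atTop, ∃ c : XCode F n,
    (∀ r t, ¬ active r t → c.M r t = 1) ∧
    (∀ r t, R r t - ε ≤ c.rate r t) ∧
    ∀ H : Coeffs F n, Compatible s H → c.errorProb H ≤ ε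

/-- `S` is the sum capacity: the supremum of the achievable sum rates. -/
def IsSumCapacity (F : Type*) [Field F] (s : ℕ → ConnState) (active : Fin 2 → Fin 2 → Prop)
    (S : ℝ) : Prop :=
  IsLUB {x : ℝ | ∃ R, Achievable F s active R ∧ x = ∑ r, ∑ t, R r t} S

/-- `X` channel: a message from every transmitter to every receiver. -/
def xMessages : Fin 2 → Fin 2 → Prop := fun _ _ => True

/-- Interference channel: only the messages from transmitter `k` to receiver `k`. -/
def icMessages : Fin 2 → Fin 2 → Prop := fun r t => r = t

/-!
Upper bound. A fraction bounded below of the message tuples is decoded correctly for finitely many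
prescribed coefficient sequences. On the uniform distribution over these tuples decoding is exact,
so the converse becomes a computation with submodularity of Shannon entropy (`entropy_submodular`),
without Fano's inequality. All coefficients are taken to be `1`, except that the cross links in the
states `A` and `B` have the value `1` or a second value `g ∉ {0, 1}`, which exists as `|F| > 2`.

* `two_mul_log_card_le_of_two_coeffs` gives the sum rate bound `1 + λ_D + (λ_A + λ_B) / 2`. Both
  values of the cross coefficient allow receiver 1 to decode, so the messages of receiver 1 are part
  of the common information of its two observations, while the two observations together resolve
  both inputs in state `A`. Combined with the same statement for receiver 2, several applications of
  submodularity yield the bound. In state `C` both receivers see the same sum.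
* `two_mul_log_card_le_of_genie` gives the sum rate bound `1 + λ_C + λ_D`. Receiver 2 hears
  transmitter 1 in the states `B` and `C` only. By the independence of the messages (in the form of
  fixing a good message pair of transmitter 2, `XCode.exists_card_mix_left_le`), the input of
  transmitter 1 in these states determines the cross message of transmitter 1. Hence receiver 1,
  once it also knows the input of transmitter 1 in state `C`, knows all messages of transmitter 1.

Lower bound. Already the interference channel achieves the sum rate without errors
(`exists_zero_error_xCode`). Three channel uses, one in each of the states `A`, `B`, `C`, carry four
symbols: both transmitters send fresh symbols in `A` and `B`, and in `C` transmitter 1 repeats its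
symbol of `B` and transmitter 2 its symbol of `A`. Of these two, receiver 1 already knows the former
and receiver 2 the latter, so that each learns its interference, whatever the coefficients are.
State `D` carries two symbols and every remaining channel use one.
-/

/-! ### Entropy of functions on a finite uniform probability space -/

section Entropy

variable {Ω : Type*} [Fintype Ω] {α β γ δ : Type*}

open Classical in
/-- The number of points at which `f` takes the same value as at `a`. -/
noncomputable def fiberCard (f : Ω → α) (a : Ω) : ℕ :=
  (Finset.univ.filter fun b => f b = f a).card

/-- Shannon entropy (in nats) of the random variable `f` on `Ω` with its uniform distribution: the
average of `log (|Ω| / |fiber|)`. -/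
noncomputable def entropy (f : Ω → α) : ℝ :=
  Real.log (Fintype.card Ω) - (∑ a, Real.log (fiberCard f a)) / Fintype.card Ω

lemma fiberCard_pos (f : Ω → α) (a : Ω) : 0 < fiberCard f a := by
  classical
  exact Finset.card_pos.2 ⟨a, by simp⟩

lemma fiberCard_congr {f : Ω → α} {a b : Ω} (h : f a = f b) : fiberCard f a = fiberCard f b := by
  unfold fiberCard
  rw [h]

open Classical in
lemma fiberCard_eq_sum (f : Ω → α) (a : Ω) :
    (fiberCard f a : ℝ) = ∑ b, if f b = f a then (1 : ℝ) else 0 := by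
  simp [fiberCard]

lemma entropy_mono {f : Ω → α} {g : Ω → β} (h : ∀ a b, f a = f b → g a = g b) :
    entropy g ≤ entropy f := by
  classical
  unfold entropy
  have : ∑ a, Real.log (fiberCard f a) ≤ ∑ a, Real.log (fiberCard g a) := by
    refine Finset.sum_le_sum fun a _ => Real.log_le_log (by exact_mod_cast fiberCard_pos f a) ?_
    exact_mod_cast Finset.card_le_card fun b hb => by
      simp only [Finset.mem_filter, Finset.mem_univ, true_and] at hb ⊢
      exact h _ _ hb
  gcongr

lemma entropy_of_injective {f : Ω → α} (h : Function.Injective f) :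
    entropy f = Real.log (Fintype.card Ω) := by
  classical
  have : ∀ a, fiberCard f a = 1 := fun a => by
    refine Finset.card_eq_one.2 ⟨a, ?_⟩
    ext b
    simp [h.eq_iff]
  simp [entropy, this]

/-- The reciprocals of the fiber sizes add up to the number of values that are taken. -/
lemma sum_inv_fiberCard_le [Fintype α] (f : Ω → α) :
    ∑ a, (1 : ℝ) / fiberCard f a ≤ Fintype.card α := by
  classical
  have key : ∀ y : α, ∑ a with f a = y, (1 : ℝ) / fiberCard f a ≤ 1 := fun y => by
    have : ∀ a ∈ Finset.univ.filter (fun a => f a = y),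
        (1 : ℝ) / fiberCard f a = 1 / (Finset.univ.filter (fun a => f a = y)).card := by
      intro a ha
      have ha : f a = y := by simpa using ha
      unfold fiberCard
      rw [ha]
    rw [Finset.sum_congr rfl this, Finset.sum_const, nsmul_eq_mul, mul_one_div]
    exact div_self_le_one _
  calc ∑ a, (1 : ℝ) / fiberCard f a
      = ∑ y : α, ∑ a with f a = y, (1 : ℝ) / fiberCard f a :=
        (Finset.sum_fiberwise _ _ _).symm
    _ ≤ ∑ _y : α, (1 : ℝ) := Finset.sum_le_sum fun y _ => key y
    _ = Fintype.card α := by simp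

lemma entropy_le_log_card [Fintype α] (f : Ω → α) : entropy f ≤ Real.log (Fintype.card α) := by
  classical
  rcases isEmpty_or_nonempty Ω with hΩ | hΩ
  · simp only [entropy, Fintype.card_eq_zero, Nat.cast_zero, Real.log_zero, div_zero, sub_zero]
    exact Real.log_natCast_nonneg _
  have hn : (0 : ℝ) < Fintype.card Ω := by exact_mod_cast Fintype.card_pos
  have hα : (0 : ℝ) < Fintype.card α := by
    have : Nonempty α := hΩ.map f
    exact_mod_cast Fintype.card_pos
  have h1 : ∀ a, Real.log (Fintype.card Ω) - Real.log (fiberCard f a) - Real.log (Fintype.card α)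
      ≤ (Fintype.card Ω / Fintype.card α : ℝ) * (1 / fiberCard f a) - 1 := fun a => by
    have hf : (0 : ℝ) < fiberCard f a := by exact_mod_cast fiberCard_pos f a
    have := Real.log_le_sub_one_of_pos
      (show (0 : ℝ) < (Fintype.card Ω / Fintype.card α : ℝ) * (1 / fiberCard f a) by positivity)
    rw [Real.log_mul (by positivity) (by positivity), Real.log_div hn.ne' hα.ne', one_div,
      Real.log_inv, ← one_div] at this
    linarith
  have h2 := Finset.sum_le_sum fun a (_ : a ∈ Finset.univ) => h1 a
  rw [Finset.sum_sub_distrib, Finset.sum_sub_distrib, Finset.sum_sub_distrib,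
    ← Finset.mul_sum] at h2
  simp only [Finset.sum_const, Finset.card_univ, nsmul_eq_mul, mul_one] at h2
  have h3 : (Fintype.card Ω / Fintype.card α : ℝ) * ∑ a, (1 : ℝ) / fiberCard f a
      ≤ Fintype.card Ω := by
    calc _ ≤ (Fintype.card Ω / Fintype.card α : ℝ) * Fintype.card α := by
          gcongr
          exact sum_inv_fiberCard_le f
      _ = _ := by field_simp
  have h4 : (∑ a, Real.log (fiberCard f a)) / Fintype.card Ω
      ≥ Real.log (Fintype.card Ω) - Real.log (Fintype.card α) := by
    rw [ge_iff_le, le_div_iff₀ hn]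
    linarith
  unfold entropy
  linarith

/-- The counting estimate behind submodularity: the weights `N_f N_g / (N_(f,g) N_k)` have mean at
most one. -/
lemma sum_fiberCard_ratio_le {f : Ω → α} {g : Ω → β} {k : Ω → δ}
    (hf : ∀ a b, f a = f b → k a = k b) (hg : ∀ a b, g a = g b → k a = k b) :
    ∑ a, ((fiberCard f a : ℝ) * fiberCard g a) /
      (fiberCard (fun x => (f x, g x)) a * fiberCard k a) ≤ Fintype.card Ω := by
  classical
  have expand : ∀ a, ((fiberCard f a : ℝ) * fiberCard g a) /
      (fiberCard (fun x => (f x, g x)) a * fiberCard k a) =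
      ∑ b, ∑ c, if f b = f a ∧ g c = g a then
        (1 : ℝ) / (fiberCard (fun x => (f x, g x)) a * fiberCard k a) else 0 := fun a => by
    rw [fiberCard_eq_sum f, fiberCard_eq_sum g, Finset.sum_mul_sum, Finset.sum_div]
    refine Finset.sum_congr rfl fun b _ => ?_
    rw [Finset.sum_div]
    refine Finset.sum_congr rfl fun c _ => ?_
    by_cases h1 : f b = f a <;> by_cases h2 : g c = g a <;> simp [h1, h2]
  have inner : ∀ b c, (∑ a, if f b = f a ∧ g c = g a then
        (1 : ℝ) / (fiberCard (fun x => (f x, g x)) a * fiberCard k a) else 0)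
      ≤ if k c = k b then (1 : ℝ) / fiberCard k b else 0 := fun b c => by
    by_cases hex : ∃ a, f b = f a ∧ g c = g a
    · obtain ⟨a₀, h1, h2⟩ := hex
      have hk : k c = k b := (hg _ _ h2).trans (hf _ _ h1).symm
      rw [if_pos hk, ← Finset.sum_filter]
      have hset : (Finset.univ.filter fun a => f b = f a ∧ g c = g a).card
          = fiberCard (fun x => (f x, g x)) a₀ := by
        unfold fiberCard
        congr 1
        ext a
        simp [h1, h2, eq_comm]
      have hval : ∀ a ∈ Finset.univ.filter (fun a => f b = f a ∧ g c = g a),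
          (1 : ℝ) / (fiberCard (fun x => (f x, g x)) a * fiberCard k a)
            = 1 / (fiberCard (fun x => (f x, g x)) a₀ * fiberCard k b) := fun a ha => by
        obtain ⟨h3, h4⟩ : f b = f a ∧ g c = g a := by simpa using ha
        rw [fiberCard_congr (f := fun x => (f x, g x)) (a := a) (b := a₀)
            (by simp [← h1, ← h2, ← h3, ← h4]),
          fiberCard_congr (f := k) (a := a) (b := b) (hf _ _ h3).symm]
      rw [Finset.sum_congr rfl hval, Finset.sum_const, hset, nsmul_eq_mul]
      have p1 : (0 : ℝ) < fiberCard (fun x => (f x, g x)) a₀ := by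
        exact_mod_cast fiberCard_pos _ _
      have p2 : (0 : ℝ) < fiberCard k b := by exact_mod_cast fiberCard_pos _ _
      apply le_of_eq
      field_simp
    · rw [Finset.sum_eq_zero fun a _ => if_neg fun h => hex ⟨a, h⟩]
      split_ifs <;> positivity
  calc _ = ∑ a, ∑ b, ∑ c, if f b = f a ∧ g c = g a then
        (1 : ℝ) / (fiberCard (fun x => (f x, g x)) a * fiberCard k a) else 0 :=
        Finset.sum_congr rfl fun a _ => expand a
    _ = ∑ b, ∑ c, ∑ a, if f b = f a ∧ g c = g a then
        (1 : ℝ) / (fiberCard (fun x => (f x, g x)) a * fiberCard k a) else 0 := by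
        rw [Finset.sum_comm]
        exact Finset.sum_congr rfl fun b _ => Finset.sum_comm
    _ ≤ ∑ b, ∑ c, if k c = k b then (1 : ℝ) / fiberCard k b else 0 :=
        Finset.sum_le_sum fun b _ => Finset.sum_le_sum fun c _ => inner b c
    _ = ∑ _b : Ω, (1 : ℝ) := by
        refine Finset.sum_congr rfl fun b _ => ?_
        have p2 : (fiberCard k b : ℝ) ≠ 0 := by exact_mod_cast (fiberCard_pos k b).ne'
        rw [← Finset.sum_filter, Finset.sum_const, nsmul_eq_mul, mul_one_div]
        exact div_self p2
    _ = Fintype.card Ω := by simp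

/-- Submodularity of entropy: `k` is a common function of `f` and of `g`, and `m` is a function of
the pair `(f, g)`. -/
lemma entropy_submodular {f : Ω → α} {g : Ω → β} {m : Ω → γ} {k : Ω → δ}
    (hf : ∀ a b, f a = f b → k a = k b) (hg : ∀ a b, g a = g b → k a = k b)
    (hm : ∀ a b, f a = f b → g a = g b → m a = m b) :
    entropy m + entropy k ≤ entropy f + entropy g := by
  classical
  set p : Ω → α × β := fun x => (f x, g x)
  have hmp : entropy m ≤ entropy p := entropy_mono fun a b h => by
    obtain ⟨h1, h2⟩ := Prod.mk.inj h
    exact hm a b h1 h2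
  have h1 : ∀ a, Real.log (fiberCard f a) + Real.log (fiberCard g a)
      - Real.log (fiberCard p a) - Real.log (fiberCard k a)
      ≤ ((fiberCard f a : ℝ) * fiberCard g a) / (fiberCard p a * fiberCard k a) - 1 := fun a => by
    have p1 : (0 : ℝ) < fiberCard f a := by exact_mod_cast fiberCard_pos _ _
    have p2 : (0 : ℝ) < fiberCard g a := by exact_mod_cast fiberCard_pos _ _
    have p3 : (0 : ℝ) < fiberCard p a := by exact_mod_cast fiberCard_pos _ _
    have p4 : (0 : ℝ) < fiberCard k a := by exact_mod_cast fiberCard_pos _ _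
    have := Real.log_le_sub_one_of_pos
      (show 0 < ((fiberCard f a : ℝ) * fiberCard g a) / (fiberCard p a * fiberCard k a) by
        positivity)
    rw [Real.log_div (by positivity) (by positivity), Real.log_mul p1.ne' p2.ne',
      Real.log_mul p3.ne' p4.ne'] at this
    linarith
  have h2 := Finset.sum_le_sum fun a (_ : a ∈ Finset.univ) => h1 a
  have h3 := sum_fiberCard_ratio_le hf hg
  simp only [Finset.sum_sub_distrib, Finset.sum_add_distrib, Finset.sum_const, Finset.card_univ,
    nsmul_eq_mul, mul_one] at h2
  have h4 : (∑ a, Real.log (fiberCard f a)) + ∑ a, Real.log (fiberCard g a)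
      ≤ (∑ a, Real.log (fiberCard p a)) + ∑ a, Real.log (fiberCard k a) := by
    linarith
  have h5 : (∑ a, Real.log (fiberCard f a)) / Fintype.card Ω
      + (∑ a, Real.log (fiberCard g a)) / Fintype.card Ω
      ≤ (∑ a, Real.log (fiberCard p a)) / Fintype.card Ω
      + (∑ a, Real.log (fiberCard k a)) / Fintype.card Ω := by
    rw [← add_div, ← add_div]
    gcongr
  have h6 : entropy p + entropy k ≤ entropy f + entropy g := by
    unfold entropy
    linarith
  linarith

/-- A function of `f` and of a variable `g` with values in a finite type. -/
lemma entropy_le_add_log_card [Fintype β] {f : Ω → α} {m : Ω → γ} (g : Ω → β)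
    (hm : ∀ a b, f a = f b → g a = g b → m a = m b) :
    entropy m ≤ entropy f + Real.log (Fintype.card β) := by
  have h1 := entropy_submodular (f := f) (g := g) (m := m) (k := fun _ => ())
    (fun _ _ _ => rfl) (fun _ _ _ => rfl) hm
  have h2 : 0 ≤ entropy fun _ : Ω => () := by
    have : entropy (fun _ : Ω => ()) = 0 := by
      rcases isEmpty_or_nonempty Ω with hΩ | hΩ
      · simp [entropy]
      · simp [entropy, fiberCard]
    exact this.ge
  linarith [entropy_le_log_card g]

end Entropy

/-! ### Entropy inequalities for the two receivers -/

section Converse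

variable {F : Type*} [Field F] {n : ℕ}

/-- The channel uses below `n` that are in state `σ`. -/
def slots (s : ℕ → ConnState) (n : ℕ) (σ : ConnState) : Finset (Fin n) :=
  Finset.univ.filter fun i => s i = σ

lemma mem_slots {s : ℕ → ConnState} {σ : ConnState} {i : Fin n} :
    i ∈ slots s n σ ↔ s i = σ := by
  simp [slots]

/-- Coefficients compatible with the state `σ`: direct links and the links of state `C` have
coefficient `1`, the only cross link of the states `A` and `B` has coefficient `g`. -/
def crossCoeff (g : F) : ConnState → Fin 2 → Fin 2 → F
  | .A => !![1, g; 0, 1]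
  | .B => !![1, 0; g, 1]
  | .C => !![1, 1; 1, 1]
  | .D => !![1, 0; 0, 1]

lemma compatible_crossCoeff (s : ℕ → ConnState) {g : F} (hg : g ≠ 0) :
    Compatible s (fun i : Fin n => crossCoeff g (s i)) := by
  have key : ∀ σ r t, crossCoeff g σ r t ≠ 0 ↔ Linked σ r t := by
    intro σ r t
    cases σ <;> fin_cases r <;> fin_cases t <;> simp [crossCoeff, Linked, hg]
  exact fun i r t => key (s i) r t

/-- The symbol that receiver `r` observes in state `σ` if `u` and `v` are sent by transmitters 1 and
2 and the coefficients are `crossCoeff g σ`. -/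
def received (g : F) (r : Fin 2) (σ : ConnState) (u v : F) : F :=
  crossCoeff g σ r 0 * u + crossCoeff g σ r 1 * v

section received

variable (g u v : F)

@[simp] lemma received_zero_A : received g 0 .A u v = u + g * v := by simp [received, crossCoeff]
@[simp] lemma received_zero_B : received g 0 .B u v = u := by simp [received, crossCoeff]
@[simp] lemma received_zero_C : received g 0 .C u v = u + v := by simp [received, crossCoeff]
@[simp] lemma received_zero_D : received g 0 .D u v = u := by simp [received, crossCoeff]
@[simp] lemma received_one_A : received g 1 .A u v = v := by simp [received, crossCoeff]
@[simp] lemma received_one_B : received g 1 .B u v = g * u + v := by simp [received, crossCoeff]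
@[simp] lemma received_one_C : received g 1 .C u v = u + v := by simp [received, crossCoeff]
@[simp] lemma received_one_D : received g 1 .D u v = v := by simp [received, crossCoeff]

end received

variable {Ω α β γ γ' δ : Type*}

/-- The random variable that consists of the symbols `φ (s i) (x₁ i) (x₂ i)`. -/
def view (s : ℕ → ConnState) (x₁ x₂ : Ω → Fin n → F)
    (φ : ConnState → F → F → γ) (a : Ω) (i : Fin n) : γ :=
  φ (s i) (x₁ a i) (x₂ a i)

section view

variable {s : ℕ → ConnState} {x₁ x₂ : Ω → Fin n → F}

omit [Field F] in
lemma view_determines {φ : ConnState → F → F → γ} {ψ : ConnState → F → F → δ}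
    (h : ∀ σ u v u' v', φ σ u v = φ σ u' v' → ψ σ u v = ψ σ u' v') (a b : Ω)
    (hab : view s x₁ x₂ φ a = view s x₁ x₂ φ b) : view s x₁ x₂ ψ a = view s x₁ x₂ ψ b :=
  funext fun i => h _ _ _ _ _ (congr_fun hab i)

omit [Field F] in
lemma views_determine {φ : ConnState → F → F → γ} {φ' : ConnState → F → F → γ'}
    {ψ : ConnState → F → F → δ}
    (h : ∀ σ u v u' v', φ σ u v = φ σ u' v' → φ' σ u v = φ' σ u' v' → ψ σ u v = ψ σ u' v')
    (a b : Ω) (hab : view s x₁ x₂ φ a = view s x₁ x₂ φ b)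
    (hab' : view s x₁ x₂ φ' a = view s x₁ x₂ φ' b) : view s x₁ x₂ ψ a = view s x₁ x₂ ψ b :=
  funext fun i => h _ _ _ _ _ (congr_fun hab i) (congr_fun hab' i)

variable [Fintype Ω]

omit [Field F] in
lemma entropy_view_le_length [Fintype F] (φ : ConnState → F → F → F) :
    entropy (view s x₁ x₂ φ) ≤ n * Real.log (Nat.card F) := by
  simpa using entropy_le_log_card (view s x₁ x₂ φ)

omit [Field F] in
/-- If `ψ` is determined by `φ` and, in the states of `S`, by `φ` and one more symbol, then the
entropy of the view `ψ` exceeds that of the view `φ` by at most one symbol for each channel use in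
a state of `S`. -/
lemma entropy_view_le_add [Fintype F] {φ : ConnState → F → F → γ} {ψ : ConnState → F → F → δ}
    (S : Finset ConnState) (y : ConnState → F → F → F)
    (h : ∀ σ u v u' v', φ σ u v = φ σ u' v' → (σ ∈ S → y σ u v = y σ u' v') →
      ψ σ u v = ψ σ u' v') :
    entropy (view s x₁ x₂ ψ) ≤
      entropy (view s x₁ x₂ φ) + (∑ σ ∈ S, (slots s n σ).card : ℕ) * Real.log (Nat.card F) := by
  classical
  let T : Finset (Fin n) := S.biUnion (slots s n)
  have hT : T.card ≤ ∑ σ ∈ S, (slots s n σ).card := Finset.card_biUnion_le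
  have h1 := entropy_le_add_log_card (f := view s x₁ x₂ φ) (m := view s x₁ x₂ ψ)
    (fun a (i : T) => view s x₁ x₂ y a i) fun a b h1 h2 => funext fun i =>
      h _ _ _ _ _ (congr_fun h1 i) fun hi =>
        congr_fun h2 ⟨i, Finset.mem_biUnion.2 ⟨s i, hi, mem_slots.2 rfl⟩⟩
  have h2 : (T.card : ℝ) * Real.log (Nat.card F)
      ≤ (∑ σ ∈ S, (slots s n σ).card : ℕ) * Real.log (Nat.card F) := by
    have := Real.log_natCast_nonneg (Nat.card F)
    gcongr
  have h3 : Real.log (Fintype.card (T → F)) = T.card * Real.log (Nat.card F) := by simp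
  linarith

end view

variable [Fintype Ω]

/-- The entropy bound behind `1 + λ_D + (λ_A + λ_B) / 2`. Each receiver decodes its own messages for
the two cross coefficients `1` and `g`. The observations `P 1`, `P g` of receiver 1 together give
both inputs in state `A`, while what they have in common contains, besides `G₁`, the messages of
receiver 1. Submodularity for these two observations, for those of receiver 2, and for the resulting
variables gives `H(P 1) + H(P g) + H(Q 1) + H(Q g) ≥ 2 log |Ω| + H(G₁) + H(G₂)`, and `P g`
(resp. `Q g`) exceeds `G₁` (resp. `G₂`) by the symbols of state `A` (resp. `B`) only. -/
lemma two_mul_log_card_le_of_two_coeffs [Fintype F] (s : ℕ → ConnState) (x₁ x₂ : Ω → Fin n → F)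
    (w₁ : Ω → α) (w₂ : Ω → β) {g : F} (hg1 : g ≠ 1)
    (hdec : ∀ c : F, c = 1 ∨ c = g →
      (∀ a b, view s x₁ x₂ (received c 0) a = view s x₁ x₂ (received c 0) b → w₁ a = w₁ b) ∧
      (∀ a b, view s x₁ x₂ (received c 1) a = view s x₁ x₂ (received c 1) b → w₂ a = w₂ b))
    (hinj : ∀ a b, w₁ a = w₁ b → w₂ a = w₂ b → a = b) :
    2 * Real.log (Fintype.card Ω) ≤
      (2 * n + 2 * (slots s n .D).card + (slots s n .A).card + (slots s n .B).card)
        * Real.log (Nat.card F) := by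
  classical
  -- in state `D` both inputs are given to both receivers
  let p (c : F) : ConnState → F → F → F × F :=
    fun σ u v => (received c 0 σ u v, if σ = .D then v else 0)
  let q (c : F) : ConnState → F → F → F × F :=
    fun σ u v => (received c 1 σ u v, if σ = .D then u else 0)
  let g₁ : ConnState → F → F → F × F
    | .A, _, _ => (0, 0) | .B, u, _ => (u, 0) | .C, u, v => (u + v, 0) | .D, u, v => (u, v)
  let g₂ : ConnState → F → F → F × F
    | .A, _, v => (v, 0) | .B, _, _ => (0, 0) | .C, u, v => (u + v, 0) | .D, u, v => (u, v)
  let k : ConnState → F → F → F × F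
    | .A, _, v => (v, 0) | .B, u, _ => (u, 0) | .C, u, v => (u + v, 0) | .D, u, v => (u, v)
  let P := fun c => view s x₁ x₂ (p c)
  let Q := fun c => view s x₁ x₂ (q c)
  let G₁ := view s x₁ x₂ g₁
  let G₂ := view s x₁ x₂ g₂
  let K := view s x₁ x₂ k
  have hP : ∀ c, c = 1 ∨ c = g → ∀ a b, P c a = P c b → w₁ a = w₁ b := fun c hc a b h =>
    (hdec c hc).1 a b (view_determines (fun _ _ _ _ _ h => congr_arg Prod.fst h) a b h)
  have hQ : ∀ c, c = 1 ∨ c = g → ∀ a b, Q c a = Q c b → w₂ a = w₂ b := fun c hc a b h =>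
    (hdec c hc).2 a b (view_determines (fun _ _ _ _ _ h => congr_arg Prod.fst h) a b h)
  have hPG : ∀ c, ∀ a b, P c a = P c b → G₁ a = G₁ b := fun c =>
    view_determines fun σ u v u' v' => by cases σ <;> simp +contextual [p, g₁]
  have hQG : ∀ c, ∀ a b, Q c a = Q c b → G₂ a = G₂ b := fun c =>
    view_determines fun σ u v u' v' => by cases σ <;> simp +contextual [q, g₂]
  have hcancel : ∀ u v u' v' : F, u + v = u' + v' → u + g * v = u' + g * v' → v = v' :=
    fun u v u' v' h h' => by
      have : (g - 1) * (v - v') = 0 := by linear_combination h' - h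
      exact sub_eq_zero.1 ((mul_eq_zero.1 this).resolve_left (sub_ne_zero.2 hg1))
  have hPK : ∀ a b, P 1 a = P 1 b → P g a = P g b → K a = K b :=
    views_determine fun σ u v u' v' => by
      cases σ
      · simpa [p, k] using hcancel u v u' v'
      all_goals simp +contextual [p, k]
  have hQK : ∀ a b, Q 1 a = Q 1 b → Q g a = Q g b → K a = K b :=
    views_determine fun σ u v u' v' => by
      cases σ
      case B => simpa [q, k, add_comm] using hcancel v u v' u'
      all_goals simp +contextual [q, k]
  have hKG₁ : ∀ a b, K a = K b → G₁ a = G₁ b :=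
    view_determines fun σ u v u' v' => by cases σ <;> simp +contextual [k, g₁]
  have hKG₂ : ∀ a b, K a = K b → G₂ a = G₂ b :=
    view_determines fun σ u v u' v' => by cases σ <;> simp +contextual [k, g₂]
  have hΩ : entropy (id : Ω → Ω) = Real.log (Fintype.card Ω) :=
    entropy_of_injective Function.injective_id
  -- submodularity for pairs of observations of one receiver
  have e1 : entropy (fun a => (P 1 a, P g a)) + entropy (fun a => (w₁ a, G₁ a))
      ≤ entropy (P 1) + entropy (P g) :=
    entropy_submodular
      (fun a b h => Prod.ext (hP 1 (Or.inl rfl) a b h) (hPG 1 a b h))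
      (fun a b h => Prod.ext (hP g (Or.inr rfl) a b h) (hPG g a b h))
      (fun a b h h' => Prod.ext h h')
  have e2 : entropy (fun a => (Q 1 a, Q g a)) + entropy (fun a => (w₂ a, G₂ a))
      ≤ entropy (Q 1) + entropy (Q g) :=
    entropy_submodular
      (fun a b h => Prod.ext (hQ 1 (Or.inl rfl) a b h) (hQG 1 a b h))
      (fun a b h => Prod.ext (hQ g (Or.inr rfl) a b h) (hQG g a b h))
      (fun a b h h' => Prod.ext h h')
  -- the two pairs determine everything and share `K`, the union of `G₁` and `G₂`
  have e3 : entropy (id : Ω → Ω) + entropy K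
      ≤ entropy (fun a => (P 1 a, P g a)) + entropy (fun a => (Q 1 a, Q g a)) :=
    entropy_submodular
      (fun a b h => hPK a b (Prod.mk.inj h).1 (Prod.mk.inj h).2)
      (fun a b h => hQK a b (Prod.mk.inj h).1 (Prod.mk.inj h).2)
      (fun a b h h' => hinj a b (hP 1 (Or.inl rfl) a b (Prod.mk.inj h).1)
        (hQ 1 (Or.inl rfl) a b (Prod.mk.inj h').1))
  -- the common parts are completed to `K`
  have e4 : entropy (fun a => (w₁ a, K a)) + entropy G₁
      ≤ entropy (fun a => (w₁ a, G₁ a)) + entropy K :=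
    entropy_submodular (fun a b h => (Prod.mk.inj h).2) hKG₁
      (fun a b h h' => Prod.ext (Prod.mk.inj h).1 h')
  have e5 : entropy (fun a => (w₂ a, K a)) + entropy G₂
      ≤ entropy (fun a => (w₂ a, G₂ a)) + entropy K :=
    entropy_submodular (fun a b h => (Prod.mk.inj h).2) hKG₂
      (fun a b h h' => Prod.ext (Prod.mk.inj h).1 h')
  have e6 : entropy (id : Ω → Ω) + entropy K
      ≤ entropy (fun a => (w₁ a, K a)) + entropy (fun a => (w₂ a, K a)) :=
    entropy_submodular (fun a b h => (Prod.mk.inj h).2) (fun a b h => (Prod.mk.inj h).2)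
      (fun a b h h' => hinj a b (Prod.mk.inj h).1 (Prod.mk.inj h').1)
  -- sizes of the observations
  have e7 : entropy (P g) ≤ entropy G₁ + _ :=
    entropy_view_le_add {.A} (received g 0) fun σ u v u' v' => by
      cases σ <;> simp +contextual [p, g₁]
  have e8 : entropy (Q g) ≤ entropy G₂ + _ :=
    entropy_view_le_add {.B} (received g 1) fun σ u v u' v' => by
      cases σ <;> simp +contextual [q, g₂]
  have e9 : entropy (P 1) ≤ entropy (view s x₁ x₂ (received 1 0)) + _ :=
    entropy_view_le_add {.D} (fun _ _ v => v) fun σ u v u' v' => by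
      cases σ <;> simp +contextual [p]
  have e10 : entropy (Q 1) ≤ entropy (view s x₁ x₂ (received 1 1)) + _ :=
    entropy_view_le_add {.D} (fun _ u _ => u) fun σ u v u' v' => by
      cases σ <;> simp +contextual [q]
  have e11 := entropy_view_le_length (s := s) (x₁ := x₁) (x₂ := x₂) (received 1 0)
  have e12 := entropy_view_le_length (s := s) (x₁ := x₁) (x₂ := x₂) (received 1 1)
  rw [hΩ] at e3 e6
  simp only [Finset.sum_singleton] at e7 e8 e9 e10
  linarith

/-- The entropy bound behind `1 + λ_C + λ_D`. Each receiver is also given what the transmitter with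
the same index sends in state `C`. By `h₁` and `h₂` it then knows all messages of that transmitter,
hence also what it hears of the other one. -/
lemma two_mul_log_card_le_of_genie [Fintype F] [Fintype α] [Fintype β] (s : ℕ → ConnState)
    (x₁ x₂ : Ω → Fin n → F) (t₁ : Ω → α) (t₂ : Ω → β)
    (hx₁ : ∀ a b, t₁ a = t₁ b → x₁ a = x₁ b) (hx₂ : ∀ a b, t₂ a = t₂ b → x₂ a = x₂ b)
    (hinj : ∀ a b, t₁ a = t₁ b → t₂ a = t₂ b → a = b)
    (h₁ : ∀ a b, view s x₁ x₂ (received 1 0) a = view s x₁ x₂ (received 1 0) b →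
      (∀ i : Fin n, s i = .B ∨ s i = .C → x₁ a i = x₁ b i) → t₁ a = t₁ b)
    (h₂ : ∀ a b, view s x₁ x₂ (received 1 1) a = view s x₁ x₂ (received 1 1) b →
      (∀ i : Fin n, s i = .A ∨ s i = .C → x₂ a i = x₂ b i) → t₂ a = t₂ b) :
    2 * Real.log (Fintype.card Ω) ≤ Real.log (Fintype.card α) + Real.log (Fintype.card β) +
      ((slots s n .A).card + (slots s n .B).card + 2 * (slots s n .C).card
        + 2 * (slots s n .D).card) * Real.log (Nat.card F) := by
  classical
  let p : ConnState → F → F → F × F := fun σ u v => (received 1 0 σ u v, if σ = .C then u else 0)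
  let q : ConnState → F → F → F × F := fun σ u v => (received 1 1 σ u v, if σ = .C then v else 0)
  let v₁ : ConnState → F → F → F := fun σ u _ => if σ = .B ∨ σ = .C then u else 0
  let v₂ : ConnState → F → F → F := fun σ _ v => if σ = .A ∨ σ = .C then v else 0
  let P := view s x₁ x₂ p
  let Q := view s x₁ x₂ q
  let V₁ := view s x₁ x₂ v₁
  let V₂ := view s x₁ x₂ v₂
  have hPt : ∀ a b, P a = P b → t₁ a = t₁ b := fun a b h =>
    h₁ a b (view_determines (fun _ _ _ _ _ h => congr_arg Prod.fst h) a b h) fun i hi => by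
      have := congr_fun (view_determines (ψ := v₁) (fun σ u v u' v' => by
        cases σ <;> simp +contextual [p, v₁]) a b h) i
      simpa [view, v₁, hi] using this
  have hQt : ∀ a b, Q a = Q b → t₂ a = t₂ b := fun a b h =>
    h₂ a b (view_determines (fun _ _ _ _ _ h => congr_arg Prod.fst h) a b h) fun i hi => by
      have := congr_fun (view_determines (ψ := v₂) (fun σ u v u' v' => by
        cases σ <;> simp +contextual [q, v₂]) a b h) i
      simpa [view, v₂, hi] using this
  have hPV : ∀ a b, P a = P b → V₂ a = V₂ b := fun a b h => by
    refine views_determine (φ := p) (φ' := fun _ u _ => u) (fun σ u v u' v' => ?_) a b h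
      (hx₁ a b (hPt a b h))
    cases σ <;> simp only [p, v₂, Prod.mk.injEq] <;> simp <;> rintro h rfl <;> simpa using h
  have hQV : ∀ a b, Q a = Q b → V₁ a = V₁ b := fun a b h => by
    refine views_determine (φ := q) (φ' := fun _ _ v => v) (fun σ u v u' v' => ?_) a b h
      (hx₂ a b (hQt a b h))
    cases σ <;> simp only [q, v₁, Prod.mk.injEq] <;> simp <;> rintro h rfl <;> simpa using h
  have hV₁ : ∀ a b, t₁ a = t₁ b → V₁ a = V₁ b := fun a b h => funext fun i => by
    simp only [V₁, view, v₁, hx₁ a b h]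
  have hV₂ : ∀ a b, t₂ a = t₂ b → V₂ a = V₂ b := fun a b h => funext fun i => by
    simp only [V₂, view, v₂, hx₂ a b h]
  have hΩ : entropy (id : Ω → Ω) = Real.log (Fintype.card Ω) :=
    entropy_of_injective Function.injective_id
  have e1 : entropy (id : Ω → Ω) + entropy V₂ ≤ entropy P + entropy t₂ :=
    entropy_submodular hPV hV₂ fun a b h h' => hinj a b (hPt a b h) h'
  have e2 : entropy (id : Ω → Ω) + entropy V₁ ≤ entropy Q + entropy t₁ :=
    entropy_submodular hQV hV₁ fun a b h h' => hinj a b h' (hQt a b h)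
  have e3 : entropy P ≤ entropy V₁ + _ :=
    entropy_view_le_add {.A, .C, .D} (received 1 0) fun σ u v u' v' => by
      cases σ <;> simp +contextual [p, v₁]
  have e4 : entropy Q ≤ entropy V₂ + _ :=
    entropy_view_le_add {.B, .C, .D} (received 1 1) fun σ u v u' v' => by
      cases σ <;> simp +contextual [q, v₂]
  have e5 := entropy_le_log_card t₁
  have e6 := entropy_le_log_card t₂
  simp [-Nat.card_eq_fintype_card] at e3 e4
  rw [hΩ] at e1 e2
  linarith

end Converse

/-! ### Converse for codes with small error probability -/

section CodeConverse

namespace XCode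

variable {F : Type*} [Field F] {n : ℕ}

omit [Field F] in
lemma msgs_ext {c : XCode F n} {W W' : c.Msgs} (h0 : ∀ r, W r 0 = W' r 0)
    (h1 : ∀ r, W r 1 = W' r 1) : W = W' := by
  funext r t
  fin_cases t
  · exact h0 r
  · exact h1 r

instance (c : XCode F n) : Nonempty c.Msgs := ⟨fun r t => ⟨0, c.M_pos r t⟩⟩

open Classical in
/-- The message tuples that are not decoded correctly for the coefficients `H`. -/
noncomputable def badSet (c : XCode F n) (H : Coeffs F n) : Finset c.Msgs :=
  Finset.univ.filter fun W => ∃ r, c.dec r H (c.output H W r) ≠ W r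

/-- The threshold `1 / 6` leaves half of the message tuples after the removal of up to three sets of
this size. -/
lemma six_mul_card_badSet_le (c : XCode F n) {H : Coeffs F n} (h : c.errorProb H ≤ 1 / 6) :
    6 * (c.badSet H).card ≤ Fintype.card c.Msgs := by
  classical
  have hpos : (0 : ℝ) < Fintype.card c.Msgs := by exact_mod_cast Fintype.card_pos
  have h1 : ((c.badSet H).card : ℝ) / Fintype.card c.Msgs ≤ 1 / 6 := by
    simpa [errorProb, badSet, Fintype.card_subtype] using h
  rw [div_le_iff₀ hpos] at h1
  have : (6 * (c.badSet H).card : ℝ) ≤ Fintype.card c.Msgs := by linarith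
  exact_mod_cast this

/-- Outside of `badSet` the output at a receiver determines the messages for that receiver. -/
lemma eq_of_output_eq {c : XCode F n} {H : Coeffs F n} {W W' : c.Msgs} (hW : W ∉ c.badSet H)
    (hW' : W' ∉ c.badSet H) {r : Fin 2} (h : c.output H W r = c.output H W' r) : W r = W' r := by
  simp only [badSet, Finset.mem_filter, Finset.mem_univ, true_and, not_exists, not_not] at hW hW'
  rw [← hW r, ← hW' r, h]

/-- The input of transmitter `t`. -/
def input (c : XCode F n) (t : Fin 2) (W : c.Msgs) : Fin n → F := c.enc t fun r => W r t

lemma output_crossCoeff (c : XCode F n) (s : ℕ → ConnState) (g : F) (W : c.Msgs) (r : Fin 2) :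
    c.output (fun i => crossCoeff g (s i)) W r
      = view s (c.input 0) (c.input 1) (received g r) W := by
  funext i
  simp [output, view, received, input]

/-- The message tuple with the messages of transmitter 1 from `W` and those of transmitter 2
from `W'`. -/
def mix {c : XCode F n} (W W' : c.Msgs) : c.Msgs := fun r t => if t = 0 then W r t else W' r t

omit [Field F] in
lemma mix_mix {c : XCode F n} (W W' : c.Msgs) : mix (mix W W') (mix W' W) = W := by
  funext r t
  by_cases ht : t = 0 <;> simp [mix, ht]

omit [Field F] in
open Classical in
/-- The pairs `(W, W')` and `(mix W W', mix W' W)` are in bijection, so on average over `W'` there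
are `B.card` tuples `W` with `mix W W' ∈ B`. -/
lemma sum_card_mix {c : XCode F n} (B : Finset c.Msgs) :
    ∑ W' : c.Msgs, (Finset.univ.filter fun W => mix W W' ∈ B).card
      = ∑ _W' : c.Msgs, B.card := by
  let e : c.Msgs × c.Msgs ≃ c.Msgs × c.Msgs :=
    { toFun := fun p => (mix p.1 p.2, mix p.2 p.1)
      invFun := fun p => (mix p.1 p.2, mix p.2 p.1)
      left_inv := fun p => by simp [mix_mix]
      right_inv := fun p => by simp [mix_mix] }
  have h := Equiv.sum_comp e fun p : c.Msgs × c.Msgs => if p.1 ∈ B then 1 else 0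
  rw [Fintype.sum_prod_type_right, Fintype.sum_prod_type_right] at h
  simpa [e] using h

omit [Field F] in
open Classical in
lemma exists_card_mix_left_le {c : XCode F n} (B : Finset c.Msgs) :
    ∃ W' : c.Msgs, (Finset.univ.filter fun W => mix W W' ∈ B).card ≤ B.card := by
  obtain ⟨W', -, h⟩ := Finset.exists_le_of_sum_le Finset.univ_nonempty (sum_card_mix B).le
  exact ⟨W', h⟩

omit [Field F] in
open Classical in
lemma exists_card_mix_right_le {c : XCode F n} (B : Finset c.Msgs) :
    ∃ W' : c.Msgs, (Finset.univ.filter fun W => mix W' W ∈ B).card ≤ B.card := by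
  have h : ∑ W' : c.Msgs, (Finset.univ.filter fun W => mix W' W ∈ B).card
      = ∑ _W' : c.Msgs, B.card := by
    rw [← sum_card_mix B]
    simp only [Finset.card_filter]
    exact Finset.sum_comm
  obtain ⟨W', -, h⟩ := Finset.exists_le_of_sum_le Finset.univ_nonempty h.le
  exact ⟨W', h⟩

end XCode

lemma log_card_sub_log_two_le {α : Type*} [Fintype α] [Nonempty α] (S : Finset α)
    [Fintype {a // a ∉ S}] (hS : 2 * S.card ≤ Fintype.card α) :
    Real.log (Fintype.card α) - Real.log 2 ≤ Real.log (Fintype.card {a // a ∉ S}) := by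
  have h1 : Fintype.card {a // a ∉ S} = Fintype.card α - S.card := by
    rw [Fintype.card_subtype_compl]
    simp
  have hpos : 0 < Fintype.card α := Fintype.card_pos
  have h2 : (Fintype.card α : ℝ) / 2 ≤ Fintype.card {a // a ∉ S} := by
    have : Fintype.card α ≤ 2 * Fintype.card {a // a ∉ S} := by omega
    have : (Fintype.card α : ℝ) ≤ 2 * Fintype.card {a // a ∉ S} := by exact_mod_cast this
    linarith
  rw [← Real.log_div (by positivity) (by norm_num)]
  exact Real.log_le_log (by positivity) h2

namespace XCode

variable {F : Type*} [Field F] [Fintype F] {n : ℕ}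

/-- Converse behind `1 + λ_D + (λ_A + λ_B) / 2`. -/
lemma log_card_msgs_le_of_two_coeffs (c : XCode F n) (s : ℕ → ConnState) {g : F} (hg0 : g ≠ 0)
    (hg1 : g ≠ 1) (hc : ∀ H, Compatible s H → c.errorProb H ≤ 1 / 6) :
    2 * Real.log (Fintype.card c.Msgs) ≤ 2 * Real.log 2 +
      (2 * n + 2 * (slots s n .D).card + (slots s n .A).card + (slots s n .B).card)
        * Real.log (Nat.card F) := by
  classical
  let H : F → Coeffs F n := fun a i => crossCoeff a (s i)
  let S := c.badSet (H 1) ∪ c.badSet (H g)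
  have b1 := c.six_mul_card_badSet_le (hc (H 1) (compatible_crossCoeff s one_ne_zero))
  have bg := c.six_mul_card_badSet_le (hc (H g) (compatible_crossCoeff s hg0))
  have hS : 2 * S.card ≤ Fintype.card c.Msgs := by
    have : S.card ≤ (c.badSet (H 1)).card + (c.badSet (H g)).card := Finset.card_union_le _ _
    omega
  have hgood : ∀ a, a = 1 ∨ a = g → ∀ W : {W // W ∉ S}, W.1 ∉ c.badSet (H a) := by
    rintro a (rfl | rfl) W h
    · exact W.2 (Finset.mem_union_left _ h)
    · exact W.2 (Finset.mem_union_right _ h)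
  have hdec : ∀ a, a = 1 ∨ a = g → ∀ r (W W' : {W // W ∉ S}),
      view s (fun W : {W // W ∉ S} => c.input 0 W.1) (fun W => c.input 1 W.1) (received a r) W
        = view s (fun W : {W // W ∉ S} => c.input 0 W.1) (fun W => c.input 1 W.1) (received a r) W'
      → W.1 r = W'.1 r := fun a ha r W W' h => by
    refine eq_of_output_eq (hgood a ha W) (hgood a ha W') ?_
    rw [output_crossCoeff, output_crossCoeff]
    exact h
  have h := two_mul_log_card_le_of_two_coeffs s (fun W : {W // W ∉ S} => c.input 0 W.1)
    (fun W => c.input 1 W.1) (fun W => W.1 0) (fun W => W.1 1) hg1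
    (fun a ha => ⟨hdec a ha 0, hdec a ha 1⟩) fun W W' h0 h1 => Subtype.ext <| by
      funext r
      fin_cases r
      · exact h0
      · exact h1
  linarith [log_card_sub_log_two_le S hS]

/-- Converse behind `1 + λ_C + λ_D`. -/
lemma log_card_msgs_le_of_genie (c : XCode F n) (s : ℕ → ConnState)
    (hc : ∀ H, Compatible s H → c.errorProb H ≤ 1 / 6) :
    Real.log (Fintype.card c.Msgs) ≤ 2 * Real.log 2 +
      ((slots s n .A).card + (slots s n .B).card + 2 * (slots s n .C).card
        + 2 * (slots s n .D).card) * Real.log (Nat.card F) := by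
  classical
  let H : Coeffs F n := fun i => crossCoeff 1 (s i)
  let B := c.badSet H
  have hB := c.six_mul_card_badSet_le (hc H (compatible_crossCoeff s one_ne_zero))
  obtain ⟨U, hU⟩ := exists_card_mix_left_le B
  obtain ⟨V, hV⟩ := exists_card_mix_right_le B
  let S := B ∪ (Finset.univ.filter fun W => mix W U ∈ B) ∪
    (Finset.univ.filter fun W => mix V W ∈ B)
  have hS : 2 * S.card ≤ Fintype.card c.Msgs := by
    have h1 := Finset.card_union_le (B ∪ (Finset.univ.filter fun W => mix W U ∈ B))
      (Finset.univ.filter fun W => mix V W ∈ B)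
    have h2 := Finset.card_union_le B (Finset.univ.filter fun W => mix W U ∈ B)
    change 6 * B.card ≤ _ at hB
    change 2 * (B ∪ (Finset.univ.filter fun W => mix W U ∈ B) ∪
      (Finset.univ.filter fun W => mix V W ∈ B)).card ≤ _
    omega
  have hgood : ∀ W : {W // W ∉ S}, W.1 ∉ B ∧ mix W.1 U ∉ B ∧ mix V W.1 ∉ B := fun W => by
    have := W.2
    simp only [S, Finset.mem_union, Finset.mem_filter, Finset.mem_univ, true_and, not_or] at this
    exact ⟨this.1.1, this.1.2, this.2⟩
  have hdec : ∀ (r : Fin 2) {W W' : c.Msgs}, W ∉ B → W' ∉ B →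
      view s (c.input 0) (c.input 1) (received 1 r) W
        = view s (c.input 0) (c.input 1) (received 1 r) W' → W r = W' r :=
    fun r W W' hW hW' h => eq_of_output_eq hW hW' <| by
      rw [output_crossCoeff, output_crossCoeff]
      exact h
  have in0 : ∀ W W' : c.Msgs, c.input 0 (mix W W') = c.input 0 W := fun W W' => by
    simp [input, mix]
  have in1 : ∀ W W' : c.Msgs, c.input 1 (mix W W') = c.input 1 W' := fun W W' => by
    simp [input, mix]
  have h := two_mul_log_card_le_of_genie s (fun W : {W // W ∉ S} => c.input 0 W.1)
    (fun W => c.input 1 W.1) (fun W r => W.1 r 0) (fun W r => W.1 r 1)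
    (fun W W' h => congr_arg (c.enc 0) h) (fun W W' h => congr_arg (c.enc 1) h)
    (fun W W' h0 h1 => Subtype.ext (msgs_ext (congr_fun h0) (congr_fun h1)))
    (fun W W' h hx => by
      have e0 : W.1 0 = W'.1 0 := hdec 0 (hgood W).1 (hgood W').1 h
      -- receiver 2 hears transmitter 1 in the states `B` and `C` only
      have e1 : mix W.1 U 1 = mix W'.1 U 1 := by
        refine hdec 1 (hgood W).2.1 (hgood W').2.1 (funext fun i => ?_)
        have hi := hx i
        simp only [view, in0, in1]
        cases hs : s i <;> simp_all
      funext r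
      fin_cases r
      · exact congr_fun e0 0
      · simpa [mix] using congr_fun e1 0)
    (fun W W' h hx => by
      have e1 : W.1 1 = W'.1 1 := hdec 1 (hgood W).1 (hgood W').1 h
      -- receiver 1 hears transmitter 2 in the states `A` and `C` only
      have e0 : mix V W.1 0 = mix V W'.1 0 := by
        refine hdec 0 (hgood W).2.2 (hgood W').2.2 (funext fun i => ?_)
        have hi := hx i
        simp only [view, in0, in1]
        cases hs : s i <;> simp_all
      funext r
      fin_cases r
      · simpa [mix] using congr_fun e0 1
      · exact congr_fun e1 1)
  have hM : ∀ r t, (c.M r t : ℝ) ≠ 0 := fun r t => by exact_mod_cast (c.M_pos r t).ne'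
  have hcard : Real.log (Fintype.card ((r : Fin 2) → Fin (c.M r 0)))
      + Real.log (Fintype.card ((r : Fin 2) → Fin (c.M r 1)))
      = Real.log (Fintype.card c.Msgs) := by
    simp only [Fintype.card_pi, Fintype.card_fin, Fin.prod_univ_two, Nat.cast_mul]
    rw [← Real.log_mul (mul_ne_zero (hM _ _) (hM _ _)) (mul_ne_zero (hM _ _) (hM _ _))]
    ring_nf
  linarith [log_card_sub_log_two_le S hS]

omit [Field F] [Fintype F] in
lemma sum_rate (c : XCode F n) :
    ∑ r, ∑ t, c.rate r t = Real.log (Fintype.card c.Msgs) / (n * Real.log (Nat.card F)) := by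
  have hM : ∀ r t, (c.M r t : ℝ) ≠ 0 := fun r t => by exact_mod_cast (c.M_pos r t).ne'
  simp only [Fintype.card_pi, Fintype.card_fin, Fin.prod_univ_two, Nat.cast_mul,
    Fin.sum_univ_two, rate]
  rw [Real.log_mul (mul_ne_zero (hM _ _) (hM _ _)) (mul_ne_zero (hM _ _) (hM _ _)),
    Real.log_mul (hM _ _) (hM _ _), Real.log_mul (hM _ _) (hM _ _)]
  ring

end XCode

end CodeConverse

/-! ### Counting the states -/

section Fractions

variable {s : ℕ → ConnState} {lam : ConnState → ℝ}

lemma card_slots (s : ℕ → ConnState) (n : ℕ) (σ : ConnState) :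
    (slots s n σ).card = ((Finset.range n).filter fun i => s i = σ).card := by
  rw [← Finset.card_map Fin.valEmbedding]
  congr 1
  ext i
  simp only [Finset.mem_map, mem_slots, Fin.valEmbedding_apply, Finset.mem_filter,
    Finset.mem_range]
  exact ⟨fun ⟨j, hj, hji⟩ => hji ▸ ⟨j.2, hj⟩, fun ⟨h, hi⟩ => ⟨⟨i, h⟩, hi, rfl⟩⟩

lemma card_slots_add (s : ℕ → ConnState) (n : ℕ) :
    (slots s n .A).card + (slots s n .B).card + (slots s n .C).card + (slots s n .D).card = n := by
  simp only [slots, Finset.card_filter, ← Finset.sum_add_distrib]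
  rw [Finset.sum_congr rfl (g := fun _ => 1) fun i _ => by cases s i <;> simp]
  simp

lemma HasTimeFractions.tendsto_slots (hs : HasTimeFractions s lam) (σ : ConnState) :
    Tendsto (fun n : ℕ => ((slots s n σ).card : ℝ) / n) atTop (𝓝 (lam σ)) := by
  simpa only [card_slots] using hs σ

lemma HasTimeFractions.nonneg (hs : HasTimeFractions s lam) (σ : ConnState) : 0 ≤ lam σ :=
  ge_of_tendsto' (hs σ) fun _ => by positivity

lemma HasTimeFractions.sum_eq_one (hs : HasTimeFractions s lam) :
    lam .A + lam .B + lam .C + lam .D = 1 := by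
  have h := (((hs.tendsto_slots .A).add (hs.tendsto_slots .B)).add (hs.tendsto_slots .C)).add
    (hs.tendsto_slots .D)
  refine tendsto_nhds_unique h (tendsto_const_nhds.congr' ?_)
  filter_upwards [eventually_gt_atTop 0] with n hn
  have hn' : (n : ℝ) ≠ 0 := by exact_mod_cast hn.ne'
  rw [← add_div, ← add_div, ← add_div, eq_comm, div_eq_one_iff_eq hn']
  exact_mod_cast card_slots_add s n

end Fractions

section UpperBound

variable {F : Type*} [Field F] {s : ℕ → ConnState} {lam : ConnState → ℝ}

/-- A bound for the number of message tuples of codes with small error probability bounds all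
achievable sum rates. -/
lemma sum_rate_le_of_log_card_le (hF : 2 < Nat.card F) {active : Fin 2 → Fin 2 → Prop}
    {R : Fin 2 → Fin 2 → ℝ} (hR : Achievable F s active R) {b : ℕ → ℝ} {κ β : ℝ}
    (hb : Tendsto b atTop (𝓝 β))
    (h : ∀ n : ℕ, 0 < n → ∀ c : XCode F n, (∀ H, Compatible s H → c.errorProb H ≤ 1 / 6) →
      Real.log (Fintype.card c.Msgs) ≤ κ + b n * (n * Real.log (Nat.card F))) :
    ∑ r, ∑ t, R r t ≤ β := by
  have hL : 0 < Real.log (Nat.card F) :=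
    Real.log_pos (by exact_mod_cast (by omega : 1 < Nat.card F))
  have hlim : Tendsto (fun n : ℕ => κ / (n * Real.log (Nat.card F)) + b n) atTop (𝓝 β) := by
    have h1 : Tendsto (fun n : ℕ => κ / (n * Real.log (Nat.card F))) atTop (𝓝 0) :=
      tendsto_const_nhds.div_atTop (tendsto_natCast_atTop_atTop.atTop_mul_const hL)
    simpa using h1.add hb
  have key : ∀ ε > 0, ε ≤ 1 / 6 → ∑ r, ∑ t, R r t - 4 * ε ≤ β := fun ε hε hε6 => by
    refine ge_of_tendsto hlim ?_
    filter_upwards [hR.2 ε hε, eventually_gt_atTop 0] with n ⟨c, _, hrate, herr⟩ hn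
    have h1 := h n hn c fun H hH => (herr H hH).trans hε6
    have hnL : 0 < n * Real.log (Nat.card F) := mul_pos (by exact_mod_cast hn) hL
    have h2 : ∑ r, ∑ t, c.rate r t ≤ κ / (n * Real.log (Nat.card F)) + b n := by
      rw [c.sum_rate, div_le_iff₀ hnL, add_mul, div_mul_cancel₀ _ hnL.ne']
      exact h1
    have h3 : ∑ r, ∑ t, (R r t - ε) ≤ ∑ r, ∑ t, c.rate r t :=
      Finset.sum_le_sum fun r _ => Finset.sum_le_sum fun t _ => hrate r t
    simp only [Fin.sum_univ_two] at h2 h3 ⊢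
    linarith
  refine le_of_forall_pos_le_add fun δ hδ => ?_
  have := key (min (δ / 4) (1 / 6)) (by positivity) (min_le_right _ _)
  linarith [min_le_left (δ / 4) (1 / 6 : ℝ)]

lemma sum_rate_le [Finite F] (hF : 2 < Nat.card F) (hs : HasTimeFractions s lam)
    (hsymm : lam .A = lam .B) {active : Fin 2 → Fin 2 → Prop} {R : Fin 2 → Fin 2 → ℝ}
    (hR : Achievable F s active R) :
    ∑ r, ∑ t, R r t ≤ 1 + lam .D + min (lam .A) (lam .C) := by
  classical
  have := Fintype.ofFinite F
  have hsum := hs.sum_eq_one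
  rw [← min_add_add_left]
  refine le_min ?_ ?_
  · obtain ⟨g, hg⟩ : ∃ g : F, g ∉ ({0, 1} : Finset F) := by
      by_contra! hall
      have h1 : Fintype.card F ≤ ({0, 1} : Finset F).card :=
        Finset.card_le_card fun x _ => hall x
      have h2 := Finset.card_le_two (a := (0 : F)) (b := 1)
      rw [Nat.card_eq_fintype_card] at hF
      omega
    simp only [Finset.mem_insert, Finset.mem_singleton, not_or] at hg
    have hb := (((hs.tendsto_slots .D).const_add 1).add
      (((hs.tendsto_slots .A).add (hs.tendsto_slots .B)).div_const 2))
    refine (sum_rate_le_of_log_card_le hF hR (κ := Real.log 2) hb fun n hn c hc => ?_).trans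
      (by linarith)
    have h := c.log_card_msgs_le_of_two_coeffs s hg.1 hg.2 hc
    have hn' : (n : ℝ) ≠ 0 := by exact_mod_cast hn.ne'
    field_simp
    linarith
  · have hb := ((hs.tendsto_slots .A).add (hs.tendsto_slots .B)).add
      (((hs.tendsto_slots .C).add (hs.tendsto_slots .D)).const_mul 2)
    refine (sum_rate_le_of_log_card_le hF hR (κ := 2 * Real.log 2) hb fun n hn c hc => ?_).trans
      (by linarith)
    have h := c.log_card_msgs_le_of_genie s hc
    have hn' : (n : ℝ) ≠ 0 := by exact_mod_cast hn.ne'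
    field_simp
    linarith

end UpperBound

/-! ### A zero-error code that repeats symbols in state `C` -/

section ZeroError

variable {F : Type*} [Field F] {n : ℕ}

/-- Encoders for which every output determines the messages of its receiver form a code without
errors. -/
lemma exists_xCode_of_output_injective (s : ℕ → ConnState) (V : Fin 2 → Fin 2 → Type*)
    [∀ r t, Finite (V r t)] [∀ r t, Nonempty (V r t)]
    (e : (t : Fin 2) → ((r : Fin 2) → V r t) → Fin n → F)
    (he : ∀ H : Coeffs F n, Compatible s H → ∀ (r : Fin 2) (w w' : (r t : Fin 2) → V r t),
      (∀ i, ∑ t, H i r t * e t (fun r' => w r' t) i = ∑ t, H i r t * e t (fun r' => w' r' t) i) →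
      w r = w' r) :
    ∃ c : XCode F n, (∀ r t, c.M r t = Nat.card (V r t)) ∧
      ∀ H, Compatible s H → c.errorProb H = 0 := by
  classical
  let φ : ∀ r t, V r t ≃ Fin (Nat.card (V r t)) := fun r t => Finite.equivFin _
  let decodeAll : ((r t : Fin 2) → Fin (Nat.card (V r t))) → (r t : Fin 2) → V r t :=
    fun W r t => (φ r t).symm (W r t)
  let out : Coeffs F n → ((r t : Fin 2) → Fin (Nat.card (V r t))) → Fin 2 → Fin n → F :=
    fun H W r i => ∑ t, H i r t * e t (fun r' => decodeAll W r' t) i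
  -- the decoder picks any message tuple that is consistent with the observation
  let c : XCode F n :=
    { M := fun r t => Nat.card (V r t)
      M_pos := fun r t => Nat.card_pos
      enc := fun t w => e t fun r => (φ r t).symm (w r)
      dec := fun r H y => if h : ∃ W, out H W r = y then h.choose r
        else fun t => ⟨0, Nat.card_pos⟩ }
  refine ⟨c, fun r t => rfl, fun H hH => ?_⟩
  have hdec : ∀ (W : c.Msgs) r, c.dec r H (c.output H W r) = W r := fun W r => by
    have hex : ∃ W', out H W' r = c.output H W r := ⟨W, rfl⟩
    have h1 : c.dec r H (c.output H W r) = hex.choose r := dif_pos hex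
    have h2 := he H hH r (decodeAll hex.choose) (decodeAll W) (congr_fun hex.choose_spec)
    rw [h1]
    funext t
    exact (φ r t).symm.injective (congr_fun h2 t)
  have : IsEmpty {W : c.Msgs // ∃ r, c.dec r H (c.output H W r) ≠ W r} :=
    ⟨fun W => W.2.elim fun r hr => hr (hdec W.1 r)⟩
  rw [XCode.errorProb, Nat.card_of_isEmpty, Nat.cast_zero, zero_div]

/-- A vector on `U`, extended by zero. -/
noncomputable def pad (U : Finset (Fin n)) (v : U → F) (i : Fin n) : F :=
  open Classical in if h : i ∈ U then v ⟨i, h⟩ else 0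

/-- Decoding for the difference of two message tuples. The inputs `x` and `y` repeat in the channel
uses `k j` of state `C` the symbols of `x` in `b j` (state `B`) and of `y` in `a j` (state `A`);
in the other channel uses of the states `A`, `B` and `C` only transmitter 1 is active. -/
lemma eq_zero_of_received_eq_zero {s : ℕ → ConnState} {H : Coeffs F n} (hH : Compatible s H)
    {ι : Type*} {a b k : ι → Fin n} (ha : ∀ j, s (a j) = .A) (hb : ∀ j, s (b j) = .B)
    (hk : ∀ j, s (k j) = .C) {x y : Fin n → F} (hx : ∀ j, x (k j) = x (b j))
    (hy : ∀ j, y (k j) = y (a j))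
    (hy0 : ∀ i : Fin n, s i ≠ .D → i ∉ Set.range a → i ∉ Set.range b → i ∉ Set.range k →
      y i = 0) :
    ((∀ i, H i 0 0 * x i + H i 0 1 * y i = 0) → x = 0) ∧
      ((∀ i, H i 1 0 * x i + H i 1 1 * y i = 0) → y = 0) := by
  have h00 : ∀ i, H i 0 0 ≠ 0 := fun i => (hH i 0 0).2 (by simp [Linked])
  have h11 : ∀ i, H i 1 1 ≠ 0 := fun i => (hH i 1 1).2 (by simp [Linked])
  have h01 : ∀ i : Fin n, (s i = .A ∨ s i = .C) → H i 0 1 ≠ 0 := fun i hi =>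
    (hH i 0 1).2 (by simpa [Linked] using hi)
  have h10 : ∀ i : Fin n, (s i = .B ∨ s i = .C) → H i 1 0 ≠ 0 := fun i hi =>
    (hH i 1 0).2 (by simpa [Linked] using hi)
  have h01' : ∀ i : Fin n, (s i = .B ∨ s i = .D) → H i 0 1 = 0 := fun i hi => by
    by_contra h
    have := (hH i 0 1).1 h
    rcases hi with hi | hi <;> simp [Linked, hi] at this
  have h10' : ∀ i : Fin n, (s i = .A ∨ s i = .D) → H i 1 0 = 0 := fun i hi => by
    by_contra h
    have := (hH i 1 0).1 h
    rcases hi with hi | hi <;> simp [Linked, hi] at this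
  have sep : ∀ {p : ι → Fin n} {σ : ConnState}, (∀ j, s (p j) = σ) → ∀ {i : Fin n}, s i ≠ σ →
      i ∉ Set.range p := by
    rintro p σ hp i hi ⟨j, rfl⟩
    exact hi (hp j)
  constructor
  · intro h
    have xOf : ∀ i, y i = 0 → x i = 0 := fun i hi => by simpa [hi, h00 i] using h i
    have hxB : ∀ i : Fin n, (s i = .B ∨ s i = .D) → x i = 0 := fun i hi => by
      simpa [h01' i hi, h00 i] using h i
    have hxk : ∀ j, x (k j) = 0 := fun j => (hx j).trans (hxB _ (Or.inl (hb j)))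
    have hya : ∀ j, y (a j) = 0 := fun j => by
      rw [← hy j]
      simpa [hxk j, h01 (k j) (Or.inr (hk j))] using h (k j)
    funext i
    cases hs : s i
    case B => exact hxB i (Or.inl hs)
    case D => exact hxB i (Or.inr hs)
    case A =>
      by_cases hi : i ∈ Set.range a
      · obtain ⟨j, rfl⟩ := hi
        exact xOf _ (hya j)
      · exact xOf i (hy0 i (by simp [hs]) hi (sep hb (by simp [hs])) (sep hk (by simp [hs])))
    case C =>
      by_cases hi : i ∈ Set.range k
      · obtain ⟨j, rfl⟩ := hi
        exact hxk j
      · exact xOf i (hy0 i (by simp [hs]) (sep ha (by simp [hs])) (sep hb (by simp [hs])) hi)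
  · intro h
    have hyA : ∀ i : Fin n, (s i = .A ∨ s i = .D) → y i = 0 := fun i hi => by
      simpa [h10' i hi, h11 i] using h i
    have hyk : ∀ j, y (k j) = 0 := fun j => (hy j).trans (hyA _ (Or.inl (ha j)))
    have hxb : ∀ j, x (b j) = 0 := fun j => by
      rw [← hx j]
      simpa [hyk j, h10 (k j) (Or.inr (hk j))] using h (k j)
    funext i
    cases hs : s i
    case A => exact hyA i (Or.inl hs)
    case D => exact hyA i (Or.inr hs)
    case B =>
      by_cases hi : i ∈ Set.range b
      · obtain ⟨j, rfl⟩ := hi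
        simpa [hxb j, h11 (b j)] using h (b j)
      · exact hy0 i (by simp [hs]) (sep ha (by simp [hs])) hi (sep hk (by simp [hs]))
    case C =>
      by_cases hi : i ∈ Set.range k
      · obtain ⟨j, rfl⟩ := hi
        exact hyk j
      · exact hy0 i (by simp [hs]) (sep ha (by simp [hs])) (sep hb (by simp [hs])) hi

/-- With `m` triples of channel uses in the states `A`, `B`, `C`, user 1 sends `n - m` symbols and
user 2 sends `2 m` symbols and one in each channel use of state `D`. -/
lemma exists_zero_error_xCode [Finite F] (s : ℕ → ConnState) {m : ℕ}
    (hA : m ≤ (slots s n .A).card) (hB : m ≤ (slots s n .B).card)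
    (hC : m ≤ (slots s n .C).card) :
    ∃ c : XCode F n, (∀ r t, r ≠ t → c.M r t = 1) ∧
      c.M 0 0 = Nat.card F ^ (n - m) ∧
      c.M 1 1 = Nat.card F ^ ((slots s n .D).card + 2 * m) ∧
      ∀ H, Compatible s H → c.errorProb H = 0 := by
  classical
  have := Fintype.ofFinite F
  let a := Finset.orderEmbOfCardLe _ hA
  let b := Finset.orderEmbOfCardLe _ hB
  let k := Finset.orderEmbOfCardLe _ hC
  have ha : ∀ j, s (a j) = .A := fun j => mem_slots.1 (Finset.orderEmbOfCardLe_mem _ hA j)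
  have hb : ∀ j, s (b j) = .B := fun j => mem_slots.1 (Finset.orderEmbOfCardLe_mem _ hB j)
  have hk : ∀ j, s (k j) = .C := fun j => mem_slots.1 (Finset.orderEmbOfCardLe_mem _ hC j)
  let U₁ : Finset (Fin n) := (Finset.univ.image k)ᶜ
  let U₂ : Finset (Fin n) := slots s n .D ∪ (Finset.univ.image a ∪ Finset.univ.image b)
  have cardU₁ : U₁.card = n - m := by
    simp [U₁, Finset.card_compl, Finset.card_image_of_injective _ k.injective]
  have cardU₂ : U₂.card = (slots s n .D).card + 2 * m := by
    rw [Finset.card_union_of_disjoint, Finset.card_union_of_disjoint,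
      Finset.card_image_of_injective _ a.injective, Finset.card_image_of_injective _ b.injective]
    · simp [two_mul]
    · simp only [Finset.disjoint_left, Finset.mem_image, Finset.mem_univ, true_and]
      rintro _ ⟨j, rfl⟩ ⟨j', h⟩
      simpa [h, ha] using hb j'
    · simp only [Finset.disjoint_left, Finset.mem_union, Finset.mem_image, Finset.mem_univ,
        true_and, mem_slots]
      rintro _ h1 (⟨j, rfl⟩ | ⟨j, rfl⟩)
      · simp [ha] at h1
      · simp [hb] at h1
  let U : Fin 2 → Fin 2 → Finset (Fin n) := !![U₁, ∅; ∅, U₂]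
  -- the channel use whose symbol is sent
  let ρ : Fin 2 → Fin n → Fin n :=
    ![Function.extend k b id, Function.extend k a id]
  let e : (t : Fin 2) → ((r : Fin 2) → (U r t → F)) → Fin n → F :=
    fun t w i => pad (U t t) (w t) (ρ t i)
  obtain ⟨c, hcM, hc⟩ := exists_xCode_of_output_injective s (fun r t => U r t → F) e (by
    intro H hH r w w' h
    have hρk : ∀ (p : Fin m → Fin n) j, Function.extend k p id (k j) = p j := fun p j =>
      k.injective.extend_apply _ _ _
    have hρ : ∀ (p : Fin m → Fin n) i, i ∉ Set.range k → Function.extend k p id i = i :=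
      fun p i hi => Function.extend_apply' _ _ _ hi
    have bk : ∀ j, b j ∉ Set.range k := by
      rintro j ⟨j', hj⟩
      simpa [← hj, hk] using hb j
    have ak : ∀ j, a j ∉ Set.range k := by
      rintro j ⟨j', hj⟩
      simpa [← hj, hk] using ha j
    let x : Fin 2 → Fin n → F := fun t i =>
      e t (fun r' => w r' t) i - e t (fun r' => w' r' t) i
    have key := eq_zero_of_received_eq_zero hH (a := a) (b := b) (k := k) (x := x 0) (y := x 1)
      ha hb hk
      (fun j => by simp only [x, e, ρ, Matrix.cons_val_zero, hρk, hρ b _ (bk j)])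
      (fun j => by
        simp only [x, e, ρ, Matrix.cons_val_one, Matrix.cons_val_fin_one, hρk, hρ a _ (ak j)])
      (fun i h1 h2 h3 h4 => by
        have hU : i ∉ U 1 1 := by
          simpa [U, U₂, mem_slots, h1] using And.intro (by simpa using h2) (by simpa using h3)
        simp only [x, e, ρ, Matrix.cons_val_one, Matrix.cons_val_fin_one, hρ a i h4, pad, hU]
        simp)
    have hx : x r = 0 := by
      have h' : ∀ i, H i r 0 * x 0 i + H i r 1 * x 1 i = 0 := fun i => by
        have := h i
        simp only [Fin.sum_univ_two] at this
        simp only [x]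
        linear_combination this
      fin_cases r
      · exact key.1 h'
      · exact key.2 h'
    have hrr : w r r = w' r r := by
      funext ⟨i, hi⟩
      have hi' : ρ r i = i := by
        have : i ∉ Set.range k := by
          fin_cases r
          · simpa [U, U₁] using hi
          · rintro ⟨j, rfl⟩
            have : k j ∈ U₂ := hi
            simp only [U₂, Finset.mem_union, mem_slots, hk, Finset.mem_image] at this
            rcases this with h | ⟨j', -, h⟩ | ⟨j', -, h⟩
            · cases h
            · exact ak _ ⟨_, h.symm⟩
            · exact bk _ ⟨_, h.symm⟩
        fin_cases r <;> exact hρ _ i this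
      have := congr_fun hx i
      simp only [x, e, hi', pad, hi, dif_pos, Pi.zero_apply] at this
      exact sub_eq_zero.1 this
    funext t
    by_cases hrt : r = t
    · subst hrt
      exact hrr
    · have hU : U r t = ∅ := by
        fin_cases r <;> fin_cases t <;> simp_all [U]
      funext ⟨i, hi⟩
      rw [hU] at hi
      simp at hi)
  refine ⟨c, fun r t hrt => ?_, ?_, ?_, hc⟩
  · rw [hcM]
    have hU : U r t = ∅ := by
      fin_cases r <;> fin_cases t <;> simp_all [U]
    simp [hU]
  · rw [hcM]
    simp [U, cardU₁]
  · rw [hcM]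
    simp [U, cardU₂]

end ZeroError

section LowerBound

variable {F : Type*} [Field F] [Finite F] {s : ℕ → ConnState} {lam : ConnState → ℝ}

lemma exists_achievable_ic (hF : 2 < Nat.card F) (hs : HasTimeFractions s lam)
    (hsymm : lam .A = lam .B) :
    ∃ R, Achievable F s icMessages R ∧
      1 + lam .D + min (lam .A) (lam .C) = ∑ r, ∑ t, R r t := by
  have hL : 0 < Real.log (Nat.card F) :=
    Real.log_pos (by exact_mod_cast (by omega : 1 < Nat.card F))
  have hA0 := hs.nonneg .A
  have hB0 := hs.nonneg .B
  have hC0 := hs.nonneg .C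
  have hD0 := hs.nonneg .D
  have hsum := hs.sum_eq_one
  set μ := min (lam .A) (lam .C) with hμ
  have hμ0 : 0 ≤ μ := le_min hA0 hC0
  have hμ1 : μ ≤ 1 := (min_le_left _ _).trans (by linarith)
  let m : ℕ → ℕ := fun n =>
    min (slots s n .A).card (min (slots s n .B).card (slots s n .C).card)
  have hm : Tendsto (fun n => (m n : ℝ) / n) atTop (𝓝 μ) := by
    have h := (hs.tendsto_slots .A).min ((hs.tendsto_slots .B).min (hs.tendsto_slots .C))
    rw [← hsymm, ← min_assoc, min_self] at h
    refine h.congr fun n => ?_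
    simp only [m, Nat.cast_min]
    rw [min_div_div_right (by positivity), min_div_div_right (by positivity)]
  have h1 : Tendsto (fun n : ℕ => 1 - (m n : ℝ) / n) atTop (𝓝 (1 - μ)) := hm.const_sub 1
  have h2 : Tendsto (fun n : ℕ => ((slots s n .D).card : ℝ) / n + 2 * ((m n : ℝ) / n)) atTop
      (𝓝 (lam .D + 2 * μ)) := (hs.tendsto_slots .D).add (hm.const_mul 2)
  refine ⟨!![1 - μ, 0; 0, lam .D + 2 * μ], ⟨?_, fun ε hε => ?_⟩, ?_⟩
  · intro r t
    fin_cases r <;> fin_cases t <;> simp <;> linarith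
  · filter_upwards [eventually_gt_atTop 0, h1.eventually (lt_mem_nhds (sub_lt_self _ hε)),
      h2.eventually (lt_mem_nhds (sub_lt_self _ hε))] with n hn e1 e2
    obtain ⟨c, c1, c2, c3, c4⟩ := exists_zero_error_xCode (F := F) (n := n) (m := m n) s
      (min_le_left _ _) ((min_le_right _ _).trans (min_le_left _ _))
      ((min_le_right _ _).trans (min_le_right _ _))
    have hn' : (0 : ℝ) < n := by exact_mod_cast hn
    have hrate : ∀ r t (l : ℕ), c.M r t = Nat.card F ^ l → c.rate r t = l / n := fun r t l h => by
      rw [XCode.rate, h, Nat.cast_pow, Real.log_pow]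
      field_simp
    have hmn : m n ≤ n := by
      have := card_slots_add s n
      have : m n ≤ (slots s n .A).card := min_le_left _ _
      omega
    have r00 : c.rate 0 0 = 1 - (m n : ℝ) / n := by
      rw [hrate 0 0 _ c2, Nat.cast_sub hmn]
      field_simp
    have r11 : c.rate 1 1 = ((slots s n .D).card : ℝ) / n + 2 * ((m n : ℝ) / n) := by
      rw [hrate 1 1 _ c3]
      push_cast
      field_simp
    have r0 : ∀ r t, r ≠ t → c.rate r t = 0 := fun r t h => by simp [XCode.rate, c1 r t h]
    refine ⟨c, fun r t h => c1 r t h, fun r t => ?_, fun H hH => (c4 H hH).trans_le hε.le⟩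
    fin_cases r <;> fin_cases t
    · simpa [r00] using e1.le
    · simpa [r0 0 1 (by decide)] using hε.le
    · simpa [r0 1 0 (by decide)] using hε.le
    · simpa [r11] using e2.le
  · simp [Fin.sum_univ_two]
    ring

omit [Finite F] in
lemma Achievable.xMessages {active : Fin 2 → Fin 2 → Prop} {R : Fin 2 → Fin 2 → ℝ}
    (h : Achievable F s active R) : Achievable F s xMessages R :=
  ⟨h.1, fun ε hε => (h.2 ε hε).mono fun _ ⟨c, _, hc⟩ => ⟨c, fun _ _ h => absurd trivial h, hc⟩⟩

end LowerBound

/-! ### The sum capacities -/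

theorem theorem2 (F : Type*) [Field F] [Finite F] (hF : 2 < Nat.card F)
    (s : ℕ → ConnState) (lam : ConnState → ℝ) (hs : HasTimeFractions s lam)
    (hsymm : lam .A = lam .B) :
    IsSumCapacity F s xMessages (1 + lam .D + min (lam .A) (lam .C)) ∧
    IsSumCapacity F s icMessages (1 + lam .D + min (lam .A) (lam .C)) := by
  obtain ⟨R, hR, hsum⟩ := exists_achievable_ic hF hs hsymm
  refine ⟨IsGreatest.isLUB ⟨⟨R, hR.xMessages, hsum⟩, ?_⟩, IsGreatest.isLUB ⟨⟨R, hR, hsum⟩, ?_⟩⟩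
  all_goals
    rintro x ⟨R', hR', rfl⟩
    exact sum_rate_le hF hs hsymm hR'
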